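/- **MAP.** An instance of the matching augmentation problem (MAP) is a finite loop-free 2-edge connected multigraph $G=(V,E)$, $n=|V|$, with at most two copies of each edge and with costs $\mathrm{cost}(e)\in\{0,1\}$ such that the edges of cost $0$ (zero-edges) form a matching; edges of cost $1$ are unit-edges. $\mathrm{opt}(G)$ is the minimum cost of a 2-edge connected spanning subgraph (2-ECSS). $G$ is *well-structured* if it has (i) no pair of parallel edges of costs $0$ and $1$; (ii) no redundant 4-cycle, i.e. no 4-cycle $C$ with $V(C)\ne V(G)$, two nonadjacent edges of which have cost $0$ and two nonadjacent nodes of which have degree two in $G$; (iii) no cut node; (iv) no bad-pair, i.e. no zero-edge $vw$ such that $G-\{v,w\}$ is disconnected. A 2-edge cover is an edge set such that each node is incident to at least two of its edges. For a subgraph $H$, a 2ec-block is a maximal connected bridgeless subgraph with at least two nodes; it is pendant if it is incident to exactly one bridge of $H$. Nodes in 2ec-blocks are white, all others black. A zero-bridge (unit-bridge) is a bridge of cost $0$ ($1$). **The algorithm on a well-structured instance $G$** (pre-processing leaves $G$ unchanged; all choices not specified are arbitrary): 1. *D2.* Take a minimum-cost 2-edge cover containing all zero-edges. While it has a zero-bridge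 $v_0v_1$ incident, at $v_0$, to a pendant 2ec-block $B$ of cost at most $2$, replace a unit-edge $f=v_0x$ of $B$ by a unit-edge $e$ of $G$ between $x$ and $V\setminus V(B)$. Let $\widehat{D2}$ be the result and $H=\widehat{D2}$. 2. *Bridge covering.* While $H$ has a bridge: pick a component $C_0$ of $H$ with a bridge, and as root $R$ a pendant 2ec-block of $C_0$, one that is incident to a zero-bridge if there is one. Repeat, until $R$ is incident to no bridge: pick a bridge $ru$ ($r\in R$) of $H$, a unit-bridge if $R$ is incident to one. Let $C_0$ be the component of $H$ containing $R$, and let $C_0^r,C_0^u$ be the components of $C_0-ru$ containing $r,u$. Among the paths $P$ of $G-ru$ from a node $a$ of $C_0^u$ to a node of $C_0^r$ without internal nodes in $C_0$, choose one for which the rank of $a$ is maximum and, subject to this, $|E(P)\setminus E(H)|$ is minimum; here the rank of $a$ is $\infty$ if every $r,a$-path of $C_0$ has a white node other than $r$, and otherwise it is $|E(Q)|+n\,\mathrm{cost}(Q)$ for the unique $r,a$-path $Q$ of $C_0$. Replace $H$ by $H\cup P$, except if $Q=r,u,a$ has no white node other than $r$, $\mathrm{cost}(ru)=0$, $\mathrm{cost}(ua)=1$,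 $ua$ is the only unit-bridge at $a$ and $av_3$ is a zero-bridge; in this case take also a path $P_\star$ of $G-\{a,v_3\}$, without internal nodes in $C_0$ and with $|E(P_\star)\setminus E(H)|$ minimum, between the component of $C_0-\{a,v_3\}$ containing $R$ and the rest of $C_0-\{a,v_3\}$, and replace $H$ by $(H\cup P\cup P_\star)-ua$. The new root $R$ is the 2ec-block of the new $H$ containing the old one. 3. *Gluing.* Pick a 2ec-block $R_0$ of $H$. A 2ec-block of the current $H$ is original if it is also a 2ec-block of $\widehat{D2}$ and $H$, $\widehat{D2}$ have the same edges incident to it; an original 2ec-block $B$ has $\frac34\mathrm{cost}(B)$ credits, any other one has at least $2$. Until $H$ is 2-edge connected, iterate: let $R$ be the 2ec-block of $H$ containing $R_0$, and let $\hat G$ be obtained from $G$ by contracting each 2ec-block of $H$ (and removing loops). A cycle $\hat C$ of $\hat G$ through $R$ has sufficient credit if $|\hat C|\ge3$, or $|\hat C|=2$ and its non-root node has at least two credits. - If some cycle through $R$ has sufficient credit, add the edges of such a cycle to $H$. - Otherwise pick a cycle $R,B,R$ of $\hat G$. If there are edges $e,f$ of $G$ between $R$ and $B$ whose ends $v_e\neq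 u_f$ in $B$ are adjacent in $B$, choose them such that $B$ has a unit-edge $g=v_eu_f$, add $e,f$ and remove $g$. - If there are no such $e,f$, then $B$ is a 4-cycle $v_1,v_2,v_3,v_4,v_1$, and there are edges $e,f$ between $R$ and $v_1,v_3$, respectively. If $G$ has an edge $v_2v_4$, add $e,f,v_2v_4$ and remove the unit-edges of the 4-cycle. If $v_2,v_4$ are nonadjacent in $G$, take (after exchanging $v_2$ and $v_4$ if necessary) an edge $\tilde e$ of $G$ between $v_2$ and a 2ec-block $B'\ne B,R$ of $H$ and a path $\tilde P$ of $G-v_2$ between $B'$ and $B-v_2$ with the fewest edges outside $H$; add $e,f,\tilde e$ and $E(\tilde P)$, and remove the unit-edge of the 4-cycle with both ends in $\{v_1,v_2,v_3\}$. Output $H$. **Proposition.** For every $k\in\mathbb N$ there are a well-structured MAP instance $G_k$ and an execution of the algorithm on $G_k$ with output $\mathrm{ALGO}(G_k)$ such that $$\mathrm{cost}(\mathrm{ALGO}(G_k))\ge 7k+6,\qquad \mathrm{opt}(G_k)\le 4k+7,$$ and these can be chosen such that $\mathrm{cost}(\mathrm{ALGO}(G_k))/\mathrm{opt}(G_k)\to\frac74$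 as $k\to\infty$. -/

import Mathlib

open scoped Graph

namespace MatchAug

/-! ## Multigraphs: connectivity, bridges, 2ec-blocks, paths and cycles -/

section Multigraph

universe u v

/-- `x` and `y` are joined by a walk of `H`. -/
def Reach {α : Type u} {β : Type v} (H : Graph α β) (x y : α) : Prop :=
  Relation.ReflTransGen H.Adj x y

/-- Any two nodes of `H` are joined by a walk (the empty graph is allowed). -/
def Preconnected {α : Type u} {β : Type v} (H : Graph α β) : Prop :=
  ∀ x ∈ V(H), ∀ y ∈ V(H), Reach H x y

/-- `H` is connected. -/
def Connected {α : Type u} {β : Type v} (H : Graph α β) : Prop :=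
  V(H).Nonempty ∧ Preconnected H

/-- `H` is 2-edge connected (2EC): it has at least two nodes, and the deletion of any set of fewer
than two edges leaves a connected graph. -/
def IsTwoEC {α : Type u} {β : Type v} (H : Graph α β) : Prop :=
  2 ≤ V(H).encard ∧ ∀ D ⊆ E(H), D.encard < 2 → Connected (H.deleteEdges D)

/-- The node set of the connected component of `H` that contains `x`. -/
def component {α : Type u} {β : Type v} (H : Graph α β) (x : α) : Set α :=
  {y | Reach H x y}

/-- `e` is a bridge (cut edge) of `H`: deleting it disconnects its two end nodes. -/
def IsBridge {α : Type u} {β : Type v} (H : Graph α β) (e : β) : Prop :=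
  e ∈ E(H) ∧ ∀ x y, H.IsLink e x y → ¬ Reach (H.deleteEdges {e}) x y

/-- The node set of the connected component containing `x` after the deletion of all bridges. -/
def blockOf {α : Type u} {β : Type v} (H : Graph α β) (x : α) : Set α :=
  component (H.deleteEdges {e | IsBridge H e}) x

/-- `B` is the node set of a 2ec-block of `H`, i.e., of a maximal connected bridgeless subgraph with
at least two nodes. These are the connected components with at least two nodes of the graph obtained
from `H` by deleting all bridges; the edges of the block are the edges of `H` with both ends
in `B`. -/
def IsBlock {α : Type u} {β : Type v} (H : Graph α β) (B : Set α) : Prop :=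
  2 ≤ B.encard ∧ ∃ x ∈ V(H), B = blockOf H x

/-- A white node of `H` is a node of a 2ec-block of `H`; the other nodes are black. -/
def IsWhite {α : Type u} {β : Type v} (H : Graph α β) (x : α) : Prop :=
  ∃ B, IsBlock H B ∧ x ∈ B

/-- The edge `e` of `H` is incident to the node set `B`. -/
def Touches {α : Type u} {β : Type v} (H : Graph α β) (e : β) (B : Set α) : Prop :=
  ∃ x ∈ B, H.Inc e x

/-- A 2ec-block is pendant if it is incident to exactly one bridge. -/
def IsPendant {α : Type u} {β : Type v} (H : Graph α β) (B : Set α) : Prop :=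
  IsBlock H B ∧ {e | IsBridge H e ∧ Touches H e B}.encard = 1

/-- `IsWalk H x p y`: starting at `x`, the list `p` of pairs (edge, next node) is a walk of `H` that
ends at `y`. -/
def IsWalk {α : Type u} {β : Type v} (H : Graph α β) : α → List (β × α) → α → Prop
  | x, [], y => x ∈ V(H) ∧ x = y
  | x, s :: p, y => H.IsLink s.1 x s.2 ∧ IsWalk H s.2 p y

/-- The walk `p` from `x` to `y` is a path, i.e., its nodes are distinct. -/
def IsPath {α : Type u} {β : Type v} (H : Graph α β) (x : α) (p : List (β × α)) (y : α) : Prop :=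
  IsWalk H x p y ∧ (x :: p.map Prod.snd).Nodup

/-- The set of edges of a walk. -/
def edgesOf {α : Type u} {β : Type v} (p : List (β × α)) : Set β :=
  {e | e ∈ p.map Prod.fst}

/-- The nodes of a walk other than its first and its last one. -/
def internalNodes {α : Type u} {β : Type v} (p : List (β × α)) : List α :=
  (p.map Prod.snd).dropLast

/-- The number of edges of the walk `p` that are not in `F`. -/
noncomputable def newEdges {α : Type u} {β : Type v} (F : Set β) (p : List (β × α)) : ℕ :=
  (edgesOf p \ F).ncard

/-- `p` is (from its first node `x`) a path of `H` between the node sets `A` and `B`: it starts in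
`A`, ends in `B`, and has no internal node in either set. -/
def IsPathBetween {α : Type u} {β : Type v} (H : Graph α β) (A B : Set α) (p : List (β × α)) :
    Prop :=
  ∃ x ∈ A, ∃ y ∈ B, IsPath H x p y ∧ ∀ w ∈ internalNodes p, w ∉ A ∪ B

/-- `c` is a cycle of `H` through the node `x` (listed from `x` on). Cycles have at least two edges;
a cycle with two edges consists of two parallel edges. -/
def IsCycleAt {α : Type u} {β : Type v} (H : Graph α β) (x : α) (c : List (β × α)) : Prop :=
  2 ≤ c.length ∧ IsWalk H x c x ∧ (c.map Prod.snd).Nodup ∧ (c.map Prod.fst).Nodup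

/-- `v₁, v₂, v₃, v₄, v₁` is a 4-cycle of `H` with edges
`q₁ = v₁v₂`, `q₂ = v₂v₃`, `q₃ = v₃v₄`, `q₄ = v₄v₁`. -/
def IsFourCycle {α : Type u} {β : Type v} (H : Graph α β) (v₁ v₂ v₃ v₄ : α) (q₁ q₂ q₃ q₄ : β) :
    Prop :=
  [v₁, v₂, v₃, v₄].Nodup ∧
    H.IsLink q₁ v₁ v₂ ∧ H.IsLink q₂ v₂ v₃ ∧ H.IsLink q₃ v₃ v₄ ∧ H.IsLink q₄ v₄ v₁

end Multigraph

/-! ## Instances of the matching augmentation problem -/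

/-- An instance of MAP: a finite loop-free 2-edge connected multigraph with at most two copies of
each edge and with edge costs zero or one, such that the edges of cost zero form a matching. -/
structure MAPInstance where
  Node : Type
  Edge : Type
  finite_node : Finite Node
  finite_edge : Finite Edge
  graph : Graph Node Edge
  loopless : ∀ e x, ¬ graph.IsLink e x x
  copies_le_two : ∀ x y, {e | graph.IsLink e x y}.encard ≤ 2
  twoEC : IsTwoEC graph
  edgeCost : Edge → ℕ
  edgeCost_le_one : ∀ e ∈ E(graph), edgeCost e ≤ 1
  matching : ∀ e f x, edgeCost e = 0 → edgeCost f = 0 → graph.Inc e x → graph.Inc f x → e = f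

namespace MAPInstance

/-- The cost of a set of edges. -/
noncomputable def cost (G : MAPInstance) (F : Set G.Edge) : ℕ :=
  ∑ᶠ e ∈ F, G.edgeCost e

/-- The spanning subgraph of `G` with edge set `F`. -/
def sub (G : MAPInstance) (F : Set G.Edge) : Graph G.Node G.Edge :=
  G.graph.restrict F

/-- `F` is (the edge set of) a 2-edge connected spanning subgraph, 2-ECSS. -/
def IsTwoECSS (G : MAPInstance) (F : Set G.Edge) : Prop :=
  F ⊆ E(G.graph) ∧ IsTwoEC (G.sub F)

/-- The minimum cost of a 2-ECSS. -/
noncomputable def opt (G : MAPInstance) : ℕ :=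
  sInf {n | ∃ F, G.IsTwoECSS F ∧ G.cost F = n}

/-- `F` is a 2-edge cover: each node is incident to at least two edges of `F`. -/
def IsTwoEdgeCover (G : MAPInstance) (F : Set G.Edge) : Prop :=
  F ⊆ E(G.graph) ∧ ∀ x ∈ V(G.graph), 2 ≤ {e | e ∈ F ∧ G.graph.Inc e x}.encard

/-- `F` is a D2, i.e., a 2-edge cover of minimum cost. -/
def IsD2 (G : MAPInstance) (F : Set G.Edge) : Prop :=
  G.IsTwoEdgeCover F ∧ ∀ F', G.IsTwoEdgeCover F' → G.cost F ≤ G.cost F'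

/-- The cost of the 2ec-block with node set `B` of the subgraph with edge set `F`. -/
noncomputable def blockCost (G : MAPInstance) (F : Set G.Edge) (B : Set G.Node) : ℕ :=
  G.cost E((G.sub F).induce B)

/-! ### Well-structured instances -/

/-- There is a pair of parallel edges, one of cost zero and one of cost one. -/
def HasZeroOnePair (G : MAPInstance) : Prop :=
  ∃ e f x y, G.graph.IsLink e x y ∧ G.graph.IsLink f x y ∧ G.edgeCost e = 0 ∧ G.edgeCost f = 1

/-- There is a redundant 4-cycle: a 4-cycle that does not contain all nodes, two nonadjacent edges
of which have cost zero, and two nonadjacent nodes of which have degree two in `G`. -/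
def HasRedundantFourCycle (G : MAPInstance) : Prop :=
  ∃ u₁ u₂ u₃ u₄ q₁ q₂ q₃ q₄, IsFourCycle G.graph u₁ u₂ u₃ u₄ q₁ q₂ q₃ q₄ ∧
    ({u₁, u₂, u₃, u₄} : Set G.Node) ≠ V(G.graph) ∧
    ((G.edgeCost q₁ = 0 ∧ G.edgeCost q₃ = 0) ∨ (G.edgeCost q₂ = 0 ∧ G.edgeCost q₄ = 0)) ∧
    (((G.graph.incidenceSet u₁).encard = 2 ∧ (G.graph.incidenceSet u₃).encard = 2) ∨
      ((G.graph.incidenceSet u₂).encard = 2 ∧ (G.graph.incidenceSet u₄).encard = 2))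

/-- There is a cut node. -/
def HasCutNode (G : MAPInstance) : Prop :=
  ∃ x ∈ V(G.graph), ¬ Preconnected (G.graph.deleteVerts {x})

/-- There is a bad-pair: two nodes that are joined by an edge of cost zero and whose deletion
disconnects the graph. -/
def HasBadPair (G : MAPInstance) : Prop :=
  ∃ e x y, G.graph.IsLink e x y ∧ G.edgeCost e = 0 ∧ ¬ Preconnected (G.graph.deleteVerts {x, y})

/-- The instance is well-structured. -/
def WellStructured (G : MAPInstance) : Prop :=
  ¬ G.HasZeroOnePair ∧ ¬ G.HasRedundantFourCycle ∧ ¬ G.HasCutNode ∧ ¬ G.HasBadPair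

/-! ## The algorithm on well-structured instances

The algorithm is not deterministic: it leaves many choices open. Each of its parts is therefore
described by a relation between the current edge set and the possible next edge sets. -/

/-! ### Post-processing of D2 -/

/-- `e` is a bridge of cost zero of the subgraph `F` that is incident to the node set `B`. -/
def IsZeroBridgeAt (G : MAPInstance) (F : Set G.Edge) (e : G.Edge) (B : Set G.Node) : Prop :=
  IsBridge (G.sub F) e ∧ G.edgeCost e = 0 ∧ Touches (G.sub F) e B

/-- The set of zero-bridges of the subgraph `F` incident to pendant 2ec-blocks of cost at
most two. -/
def smallZeroBridges (G : MAPInstance) (F : Set G.Edge) : Set G.Edge :=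
  {e | ∃ B, IsPendant (G.sub F) B ∧ G.blockCost F B ≤ 2 ∧ G.IsZeroBridgeAt F e B}

/-- One iteration of post-processing: for a zero-bridge `v₀v₁` incident at `v₀` to a pendant
2ec-block `B` of cost at most two, a unit-edge `f = v₀x` of `B` is replaced by a unit-edge `e` of
the instance between `x` and a node outside `B`. -/
inductive PostProcessStep (G : MAPInstance) : Set G.Edge → Set G.Edge → Prop
  | replace (F : Set G.Edge) (B : Set G.Node) (b e f : G.Edge) (v₀ x y : G.Node)
      (hB : IsPendant (G.sub F) B) (hcost : G.blockCost F B ≤ 2)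
      (hb : IsBridge (G.sub F) b) (hb0 : G.edgeCost b = 0)
      (hv₀ : v₀ ∈ B) (hbv₀ : (G.sub F).Inc b v₀)
      (hx : x ∈ B) (hxv₀ : x ≠ v₀) (hy : y ∉ B)
      (he : G.graph.IsLink e x y) (he1 : G.edgeCost e = 1)
      (hf : (G.sub F).IsLink f v₀ x) (hf1 : G.edgeCost f = 1) :
      PostProcessStep G F (insert e (F \ {f}))

/-! ### Bridge covering -/

/-- `R` may be designated as the root 2ec-block: it is a pendant 2ec-block (of a component with a
bridge), and it is incident to a zero-bridge if some pendant 2ec-block of its component is. -/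
def IsRootChoice (G : MAPInstance) (F : Set G.Edge) (R : Set G.Node) : Prop :=
  IsPendant (G.sub F) R ∧
    ((∃ B e, IsPendant (G.sub F) B ∧ (∃ x ∈ R, ∃ y ∈ B, Reach (G.sub F) x y) ∧
        G.IsZeroBridgeAt F e B) →
      ∃ e, G.IsZeroBridgeAt F e R)

/-- `ru` (with ends `r` in `R` and `u`) may be picked as the bridge to be covered: it is a bridge
incident to `R`, and it is a unit-bridge unless `R` is incident to no unit-bridge. -/
def IsBridgeChoice (G : MAPInstance) (F : Set G.Edge) (R : Set G.Node) (ru : G.Edge)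
    (r u : G.Node) : Prop :=
  r ∈ R ∧ IsBridge (G.sub F) ru ∧ (G.sub F).IsLink ru r u ∧
    (G.edgeCost ru = 1 ∨
      ∀ e, IsBridge (G.sub F) e → Touches (G.sub F) e R → G.edgeCost e = 0)

/-- `p` is an ear covering the bridge `ru` of the component `C₀` of the subgraph `F`: a path of the
instance without `ru` from a node `a` of the component of `C₀ - ru` containing `u` to a node `z` of
the component of `C₀ - ru` containing `r`, without internal nodes in `C₀`. -/
def IsEar (G : MAPInstance) (F : Set G.Edge) (ru : G.Edge) (r u a z : G.Node)
    (p : List (G.Edge × G.Node)) : Prop :=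
  a ∈ component ((G.sub F).deleteEdges {ru}) u ∧
  z ∈ component ((G.sub F).deleteEdges {ru}) r ∧
  IsPath (G.graph.deleteEdges {ru}) a p z ∧
  ∀ w ∈ internalNodes p, w ∉ component (G.sub F) r

/-- The rank of the end node `a` of an ear. It is `⊤` if every path of the subgraph `F` between `r`
and `a` has a white node other than `r`. Otherwise there is just one path `q` between `r` and `a`,
all of its edges are bridges, and the rank is its number of edges plus `n` times its cost, where `n`
is the number of nodes of the instance (so that larger rank means larger cost, and, for the same
cost, more bridges). -/
noncomputable def prefixRank (G : MAPInstance) (F : Set G.Edge) (r a : G.Node) : ℕ∞ :=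
  ⨅ q ∈ {q : List (G.Edge × G.Node) |
      IsPath (G.sub F) r q a ∧ ∀ w ∈ q.map Prod.snd, ¬ IsWhite (G.sub F) w},
    ((q.length + V(G.graph).ncard * G.cost (edgesOf q) : ℕ) : ℕ∞)

/-- The ear `p` may be chosen: its rank is the largest possible, and subject to this it has the
minimum number of edges outside `F`. -/
def IsBestEar (G : MAPInstance) (F : Set G.Edge) (ru : G.Edge) (r u a z : G.Node)
    (p : List (G.Edge × G.Node)) : Prop :=
  G.IsEar F ru r u a z p ∧
  ∀ a' z' p', G.IsEar F ru r u a' z' p' →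
    G.prefixRank F r a' ≤ G.prefixRank F r a ∧
      (G.prefixRank F r a' = G.prefixRank F r a → newEdges F p ≤ newEdges F p')

/-- The exceptional case: the path of the subgraph `F` from `r` to the end node `a` of the ear has
two bridges, `ru` of cost zero and `e = ua` of cost one, and no white node other than `r`; moreover
`e` is the only unit-bridge incident to `a`, and `f = av₃` is a zero-bridge. -/
def IsExceptional (G : MAPInstance) (F : Set G.Edge) (ru : G.Edge) (r u a : G.Node)
    (e f : G.Edge) (v₃ : G.Node) : Prop :=
  IsPath (G.sub F) r [(ru, u), (e, a)] a ∧ ¬ IsWhite (G.sub F) u ∧ ¬ IsWhite (G.sub F) a ∧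
  G.edgeCost ru = 0 ∧ G.edgeCost e = 1 ∧
  (∀ g, IsBridge (G.sub F) g → (G.sub F).Inc g a → G.edgeCost g = 1 → g = e) ∧
  IsBridge (G.sub F) f ∧ (G.sub F).IsLink f a v₃ ∧ G.edgeCost f = 0

/-- `p` is a possible second ear in the exceptional case: a path of the instance without `a`, `v₃`
between the set `S` of nodes of the component of `C₀ - {a, v₃}` that contains `r` and the set `T` of
the other nodes of `C₀ - {a, v₃}`, without internal nodes in `C₀`. -/
def IsSecondEar (G : MAPInstance) (F : Set G.Edge) (r a v₃ : G.Node)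
    (p : List (G.Edge × G.Node)) : Prop :=
  ∃ z ∈ component ((G.sub F).deleteVerts {a, v₃}) r,
  ∃ t ∈ (component (G.sub F) r \ {a, v₃}) \ component ((G.sub F).deleteVerts {a, v₃}) r,
    IsPath (G.graph.deleteVerts {a, v₃}) z p t ∧
    ∀ w ∈ internalNodes p, w ∉ component (G.sub F) r

/-- The new root: the 2ec-block of the new subgraph that contains the old root `R` stays the root
if it is incident to a bridge; otherwise there is no root. -/
def IsNextRoot (G : MAPInstance) (F : Set G.Edge) (R : Set G.Node) (o : Option (Set G.Node)) :
    Prop :=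
  ∃ R', IsBlock (G.sub F) R' ∧ R ⊆ R' ∧
    (((∃ e, IsBridge (G.sub F) e ∧ Touches (G.sub F) e R') ∧ o = some R') ∨
      ((¬ ∃ e, IsBridge (G.sub F) e ∧ Touches (G.sub F) e R') ∧ o = none))

/-- The steps of bridge covering. A state is the current edge set with the root 2ec-block, if there
is one: designating a root, adding one ear, and, in the exceptional case, adding two ears
and discarding the unit-bridge `e` of the prefix. -/
inductive BridgeCoverStep (G : MAPInstance) :
    Set G.Edge × Option (Set G.Node) → Set G.Edge × Option (Set G.Node) → Prop
  | root (F : Set G.Edge) (R : Set G.Node) (hR : G.IsRootChoice F R) :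
      BridgeCoverStep G (F, none) (F, some R)
  | single (F : Set G.Edge) (R : Set G.Node) (ru : G.Edge) (r u a z : G.Node)
      (p : List (G.Edge × G.Node)) (o : Option (Set G.Node))
      (hru : G.IsBridgeChoice F R ru r u) (hp : G.IsBestEar F ru r u a z p)
      (hne : ¬ ∃ e f v₃, G.IsExceptional F ru r u a e f v₃)
      (ho : G.IsNextRoot (F ∪ edgesOf p) R o) :
      BridgeCoverStep G (F, some R) (F ∪ edgesOf p, o)
  | double (F : Set G.Edge) (R : Set G.Node) (ru e f : G.Edge) (r u a z v₃ : G.Node)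
      (p p' : List (G.Edge × G.Node)) (o : Option (Set G.Node))
      (hru : G.IsBridgeChoice F R ru r u) (hp : G.IsBestEar F ru r u a z p)
      (hex : G.IsExceptional F ru r u a e f v₃)
      (hp' : G.IsSecondEar F r a v₃ p')
      (hmin : ∀ p'', G.IsSecondEar F r a v₃ p'' → newEdges F p' ≤ newEdges F p'')
      (ho : G.IsNextRoot ((F ∪ edgesOf p ∪ edgesOf p') \ {e}) R o) :
      BridgeCoverStep G (F, some R) ((F ∪ edgesOf p ∪ edgesOf p') \ {e}, o)

/-! ### The gluing step -/

/-- The graph obtained from the instance by contracting each 2ec-block of the subgraph `F`. Its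
nodes are the node sets of the blocks; edges inside a block appear as loops, but loops
lie on no cycle in the sense of `IsCycleAt`. -/
def contracted (G : MAPInstance) (F : Set G.Edge) : Graph (Set G.Node) G.Edge :=
  G.graph.map (blockOf (G.sub F))

/-- `B` is an original 2ec-block of the subgraph `F`: it is also a 2ec-block of the subgraph `D`
from which bridge covering started, and both subgraphs have the same edges incident to `B`. -/
def IsOriginal (G : MAPInstance) (D F : Set G.Edge) (B : Set G.Node) : Prop :=
  IsBlock (G.sub F) B ∧ IsBlock (G.sub D) B ∧ ∀ e, Touches G.graph e B → (e ∈ F ↔ e ∈ D)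

/-- The (non-root) 2ec-block `B` has at least two working credits during gluing: each new block does,
and an original block has 3/4 credits for each of its unit-edges. -/
def HasTwoCredits (G : MAPInstance) (D F : Set G.Edge) (B : Set G.Node) : Prop :=
  G.IsOriginal D F B → (2 : ℚ) ≤ 3 / 4 * (G.blockCost F B : ℚ)

/-- The cycle `c` through the root in the contracted graph has sufficient credit: it has at least
three edges, or it has two edges and its non-root node has at least two credits. -/
def HasSufficientCredit (G : MAPInstance) (D F : Set G.Edge)
    (c : List (G.Edge × Set G.Node)) : Prop :=
  3 ≤ c.length ∨ ∀ B ∈ internalNodes c, G.HasTwoCredits D F B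

/-- `e` and `f` are edges of the instance between `R` and `B` with distinct ends `x` (of `e`) and
`y` (of `f`) in `B`. -/
def IsAttachment (G : MAPInstance) (R B : Set G.Node) (e f : G.Edge) (x y : G.Node) : Prop :=
  x ∈ B ∧ y ∈ B ∧ x ≠ y ∧ (∃ r ∈ R, G.graph.IsLink e r x) ∧ (∃ r ∈ R, G.graph.IsLink f r y)

/-- `R` is the current root of gluing: the 2ec-block of the subgraph `F` that contains the initial
root `R₀`. -/
def IsGlueRoot (G : MAPInstance) (R₀ : Set G.Node) (F : Set G.Edge) (R : Set G.Node) : Prop :=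
  IsBlock (G.sub F) R ∧ R₀ ⊆ R

/-- No cycle through the root `R` in the contracted graph has sufficient credit, and `B` is the
non-root node of such a cycle `R, B, R`. -/
def IsLowCreditChoice (G : MAPInstance) (D : Set G.Edge) (R₀ : Set G.Node) (F : Set G.Edge)
    (R B : Set G.Node) : Prop :=
  G.IsGlueRoot R₀ F R ∧
  (∀ c, IsCycleAt (G.contracted F) R c → ¬ G.HasSufficientCredit D F c) ∧
  ∃ e₁ e₂, IsCycleAt (G.contracted F) R [(e₁, B), (e₂, R)]

/-- One iteration of gluing, where `D` is the edge set from which bridge covering started and `R₀`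
is the initial root. -/
inductive GlueStep (G : MAPInstance) (D : Set G.Edge) (R₀ : Set G.Node) :
    Set G.Edge → Set G.Edge → Prop
  /-- A cycle with sufficient credit is bought. -/
  | cycle (F : Set G.Edge) (R : Set G.Node) (c : List (G.Edge × Set G.Node))
      (hR : G.IsGlueRoot R₀ F R) (hc : IsCycleAt (G.contracted F) R c)
      (hcr : G.HasSufficientCredit D F c) :
      GlueStep G D R₀ F (F ∪ edgesOf c)
  /-- `e, f` can be chosen such that the block `B` has an edge between their ends in `B`: they are
  chosen such that there is such a unit-edge `g`; buy `e, f` and discard `g`. -/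
  | adjacent (F : Set G.Edge) (R B : Set G.Node) (e f g : G.Edge) (x y : G.Node)
      (hB : G.IsLowCreditChoice D R₀ F R B) (hef : G.IsAttachment R B e f x y)
      (hg : (G.sub F).IsLink g x y) (hg1 : G.edgeCost g = 1) :
      GlueStep G D R₀ F ((F ∪ {e, f}) \ {g})
  /-- No choice of `e, f` is as above, and the block is a 4-cycle `v₁, v₂, v₃, v₄, v₁` with `e` at
  `v₁` and `f` at `v₃`, where the instance has an edge `g = v₂v₄`: buy `e, f, g` and discard the
  unit-edges of the 4-cycle. -/
  | diagonal (F : Set G.Edge) (R B : Set G.Node) (e f g q₁ q₂ q₃ q₄ : G.Edge)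
      (v₁ v₂ v₃ v₄ : G.Node)
      (hB : G.IsLowCreditChoice D R₀ F R B)
      (hna : ∀ e' f' x y, G.IsAttachment R B e' f' x y → ¬ (G.sub F).Adj x y)
      (hQ : IsFourCycle (G.sub F) v₁ v₂ v₃ v₄ q₁ q₂ q₃ q₄) (hQB : B = {v₁, v₂, v₃, v₄})
      (hef : G.IsAttachment R B e f v₁ v₃)
      (hg : G.graph.IsLink g v₂ v₄) :
      GlueStep G D R₀ F
        ((F ∪ {e, f, g}) \ {q | (q = q₁ ∨ q = q₂ ∨ q = q₃ ∨ q = q₄) ∧ G.edgeCost q = 1})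
  /-- As before, but `v₂, v₄` are nonadjacent in the instance, and `g` is an edge between `v₂` and
  another 2ec-block `B'`: take a path `p` of the instance without `v₂` between `B'` and `B - v₂`
  that has the fewest edges outside `F`, buy `e, f, g` and the edges of `p`, and discard the
  unit-edge `q` of the 4-cycle that has its ends among `v₁, v₂, v₃`. -/
  | second (F : Set G.Edge) (R B B' : Set G.Node) (e f g q q₁ q₂ q₃ q₄ : G.Edge)
      (v₁ v₂ v₃ v₄ w : G.Node) (p : List (G.Edge × G.Node))
      (hB : G.IsLowCreditChoice D R₀ F R B)
      (hna : ∀ e' f' x y, G.IsAttachment R B e' f' x y → ¬ (G.sub F).Adj x y)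
      (hQ : IsFourCycle (G.sub F) v₁ v₂ v₃ v₄ q₁ q₂ q₃ q₄) (hQB : B = {v₁, v₂, v₃, v₄})
      (hef : G.IsAttachment R B e f v₁ v₃)
      (hnadj : ¬ G.graph.Adj v₂ v₄)
      (hB' : IsBlock (G.sub F) B') (hB'B : B' ≠ B) (hB'R : B' ≠ R)
      (hw : w ∈ B') (hg : G.graph.IsLink g v₂ w)
      (hp : IsPathBetween (G.graph.deleteVerts {v₂}) B' (B \ {v₂}) p)
      (hmin : ∀ p', IsPathBetween (G.graph.deleteVerts {v₂}) B' (B \ {v₂}) p' →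
        newEdges F p ≤ newEdges F p')
      (hq : q = q₁ ∨ q = q₂) (hq1 : G.edgeCost q = 1) :
      GlueStep G D R₀ F ((F ∪ {e, f, g} ∪ edgesOf p) \ {q})

/-! ### The whole algorithm -/

/-- `A` is the edge set output by some execution of the algorithm on the (well-structured) instance
`G`: starting from a D2 that contains all zero-edges, post-processing ends with an edge set `D'`
without small zero-bridges, bridge covering ends with a bridgeless edge set `H`, and gluing, started
with a 2ec-block `R₀` of `H` as root, ends when the subgraph is 2-edge connected. (Pre-processing
leaves a well-structured instance unchanged.) -/
def IsAlgorithmOutput (G : MAPInstance) (A : Set G.Edge) : Prop :=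
  ∃ (D D' H : Set G.Edge) (R₀ : Set G.Node),
    (G.IsD2 D ∧ ∀ e ∈ E(G.graph), G.edgeCost e = 0 → e ∈ D) ∧
    (Relation.ReflTransGen G.PostProcessStep D D' ∧ G.smallZeroBridges D' = ∅) ∧
    (Relation.ReflTransGen G.BridgeCoverStep (D', none) (H, none) ∧
      ∀ e, ¬ IsBridge (G.sub H) e) ∧
    (IsBlock (G.sub H) R₀ ∧ Relation.ReflTransGen (G.GlueStep D' R₀) H A ∧ G.IsTwoECSS A)

end MAPInstance

end MatchAug

namespace MatchAug

/-! The instances are complete simple graphs; what makes them bad is the freedom of choice in the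
gluing step. Take `2n + 1` blocks of four nodes, with two disjoint zero-edges in each block, so that
the zero-edges form a perfect matching. Every node of a 2-edge cover needs a unit-edge, and a
unit-edge serves only two nodes, so every 2-edge cover costs at least `4n + 2`
(`card_le_two_mul_cost`). Two edge sets attain this bound: a Hamiltonian cycle that alternates
between zero- and unit-edges, which fixes the optimum (`opt_blockInstance`), and the disjoint union
of the alternating 4-cycles of the blocks, which is therefore a D2.

The algorithm may start from the 4-cycles. They contain all zero-edges and have no bridge, so
post-processing and bridge covering have nothing to do. Gluing may then always buy a triangle
through the root and two untouched blocks, since a cycle of three edges has sufficient credit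
whatever the blocks are (`glueStep_gluedBlocks`). Each triangle consists of three new unit-edges, so
after `n` triangles the cost is `4n + 2 + 3n = 7n + 2` (`cost_gluedBlocks`), against an optimum of
`4n + 2`.

Completeness makes well-structuredness immediate: there are no parallel edges, all degrees exceed
two, and deleting nodes leaves a complete graph. -/

lemma two_le_encard_iff_nontrivial {α : Type*} {s : Set α} : 2 ≤ s.encard ↔ s.Nontrivial := by
  rw [← not_lt, ENat.lt_two_iff, Set.encard_le_one_iff_subsingleton, Set.not_subsingleton_iff]

/-! ## Reachability and 2-edge connectivity -/

section Reachability

variable {α β : Type*} {H K : Graph α β} {x y z : α} {e : β}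

lemma Reach.symm (h : Reach H x y) : Reach H y x := by
  induction h with
  | refl => exact .refl
  | tail _ hbc ih => exact .head hbc.symm ih

lemma Reach.trans (h : Reach H x y) (h' : Reach H y z) : Reach H x z :=
  Relation.ReflTransGen.trans h h'

lemma Reach.mono (hHK : H ≤ K) (h : Reach H x y) : Reach K x y :=
  Relation.ReflTransGen.mono (fun _ _ h => Graph.Adj.mono hHK h) _ _ h

lemma _root_.Graph.IsLink.reach (h : H.IsLink e x y) : Reach H x y :=
  Relation.ReflTransGen.single ⟨e, h⟩

/-- A function that is constant along edges is constant along walks. -/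
lemma Reach.apply_eq {γ : Type*} (φ : α → γ) (hφ : ∀ e x y, H.IsLink e x y → φ x = φ y)
    (h : Reach H x y) : φ x = φ y := by
  induction h with
  | refl => rfl
  | tail _ hbc ih =>
    obtain ⟨e, he⟩ := hbc
    exact ih.trans (hφ _ _ _ he)

/-- A set of fewer than two edges is empty or a singleton, and deleting nothing keeps at least what
survives a single deletion, so only single edges have to be tested. -/
lemma isTwoEC_of_reach [Nontrivial α] [Nonempty β] (hV : V(H) = Set.univ)
    (h : ∀ e x y, Reach (H.deleteEdges {e}) x y) : IsTwoEC H := by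
  refine ⟨?_, fun D _ hD => ⟨?_, fun x _ y _ => ?_⟩⟩
  · rw [hV, two_le_encard_iff_nontrivial]
    exact Set.nontrivial_univ
  · simp [hV]
  · rw [ENat.lt_two_iff, Set.encard_le_one_iff_subsingleton] at hD
    obtain rfl | ⟨e, rfl⟩ := hD.eq_empty_or_singleton
    · exact (h (Classical.arbitrary β) x y).mono (by simp)
    · exact h e x y

lemma IsTwoEC.mono (hHK : H ≤ K) (hV : V(K) ⊆ V(H)) (h : IsTwoEC H) : IsTwoEC K := by
  refine ⟨h.1.trans (Set.encard_le_encard hHK.vertexSet_mono), fun D _ hD => ?_⟩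
  -- The deleted edges of `K` need not belong to `H`; only those that do matter for the walks of
  -- `H`.
  have hc := h.2 (D ∩ E(H)) Set.inter_subset_right
    ((Set.encard_le_encard Set.inter_subset_left).trans_lt hD)
  have hle : H.deleteEdges (D ∩ E(H)) ≤ K.deleteEdges D :=
    ⟨by simpa using hHK.vertexSet_mono, fun e x y he => by
      simp only [Graph.deleteEdges_isLink, Set.mem_inter_iff, not_and] at he ⊢
      exact ⟨hHK.isLink_mono he.1, fun hD => he.2 hD he.1.edge_mem⟩⟩
  refine ⟨hc.1.mono hle.vertexSet_mono, fun x hx y hy => (hc.2 x ?_ y ?_).mono hle⟩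
  · simpa using hV (by simpa using hx)
  · simpa using hV (by simpa using hy)

/-- Each node of a 2-edge connected graph is incident to at least two edges. -/
lemma IsTwoEC.two_le_encard_inc (h : IsTwoEC H) (hx : x ∈ V(H)) :
    2 ≤ {e | H.Inc e x}.encard := by
  by_contra! hlt
  have hc := h.2 {e | H.Inc e x} (fun e he => he.edge_mem) hlt
  obtain ⟨y, hy, hyx⟩ := (two_le_encard_iff_nontrivial.1 h.1).exists_ne x
  have hr := hc.2 x (by simpa using hx) y (by simpa using hy)
  rcases hr.cases_head with rfl | ⟨z, ⟨e, he⟩, -⟩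
  · exact hyx rfl
  · simp only [Graph.deleteEdges_isLink] at he
    exact he.2 he.1.inc_left

lemma not_isBridge_of_reach
    (h : ∀ e x y, H.IsLink e x y → Reach (H.deleteEdges {e}) x y) : ¬ IsBridge H e := by
  rintro ⟨he, hb⟩
  obtain ⟨x, y, hxy⟩ := Graph.exists_isLink_of_mem_edgeSet he
  exact hb x y hxy (h e x y hxy)

lemma blockOf_eq_component (h : ∀ e, ¬ IsBridge H e) (x : α) : blockOf H x = component H x := by
  simp [blockOf, h]

end Reachability

/-! ## Complete graphs -/

section Complete

variable {V : Type*}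

/-- The complete (simple) graph on `V`. -/
def completeGraph (V : Type*) : Graph V (Sym2 V) where
  vertexSet := Set.univ
  IsLink e x y := e = s(x, y) ∧ x ≠ y
  isLink_symm _ _ := ⟨fun _ _ h => ⟨h.1.trans Sym2.eq_swap, h.2.symm⟩⟩
  eq_or_eq_of_isLink_of_isLink := by
    rintro e x y v w ⟨rfl, -⟩ ⟨h, -⟩
    rcases Sym2.eq_iff.1 h with h | h
    · exact .inl h.1
    · exact .inr h.1
  left_mem_of_isLink _ _ _ _ := Set.mem_univ _

@[simp] lemma completeGraph_isLink {e : Sym2 V} {x y : V} :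
    (completeGraph V).IsLink e x y ↔ e = s(x, y) ∧ x ≠ y := Iff.rfl

@[simp] lemma vertexSet_completeGraph : V(completeGraph V) = Set.univ := rfl

lemma completeGraph_inc {e : Sym2 V} {x : V} (h : (completeGraph V).Inc e x) : x ∈ e := by
  obtain ⟨y, rfl, -⟩ := h
  exact Sym2.mem_mk_left x y

lemma preconnected_completeGraph_deleteVerts (X : Set V) :
    Preconnected ((completeGraph V).deleteVerts X) := by
  intro x hx y hy
  by_cases hxy : x = y
  · exact hxy ▸ .refl
  · exact Graph.IsLink.reach (e := s(x, y)) (by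
      rw [Graph.deleteVerts_isLink]
      exact ⟨⟨rfl, hxy⟩, hx.2, hy.2⟩)

/-- The nodes of a cycle with at least three nodes remain connected after the deletion of any
edge. -/
lemma reach_deleteEdges_of_cycle {F : Set (Sym2 V)} {N : ℕ} (hN : 3 ≤ N) (c : ℕ → V)
    (hc : ∀ i j, c i = c j ↔ i ≡ j [MOD N]) (hF : ∀ i, s(c i, c (i + 1)) ∈ F) (e : Sym2 V)
    (i j : ℕ) : Reach (((completeGraph V).restrict F).deleteEdges {e}) (c i) (c j) := by
  have hne (i : ℕ) : c i ≠ c (i + 1) := fun h => by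
    have := (Nat.modEq_iff_dvd' (Nat.le_succ i)).1 ((hc _ _).1 h)
    rw [show i.succ - i = 1 by omega] at this
    exact absurd (Nat.le_of_dvd one_pos this) (by omega)
  have hstep (i : ℕ) (hi : s(c i, c (i + 1)) ≠ e) :
      Reach (((completeGraph V).restrict F).deleteEdges {e}) (c i) (c (i + 1)) :=
    Graph.IsLink.reach (e := s(c i, c (i + 1))) (by simp [hF, hne, hi])
  -- Start just behind the deleted edge, or anywhere if it is not on the cycle: the next `N - 1`
  -- steps avoid it and visit all nodes.
  obtain ⟨s, hs⟩ : ∃ s, ∀ t, t + 1 < N → s(c (s + t), c (s + t + 1)) ≠ e := by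
    by_cases h : ∃ s, s(c s, c (s + 1)) = e
    · obtain ⟨s, rfl⟩ := h
      refine ⟨s + 1, fun t ht h => ?_⟩
      have key (d : ℕ) (hd : 0 < d) (hdN : d < N) (h : c (s + d) = c s) : False := by
        have := (Nat.modEq_iff_dvd' (Nat.le_add_right s d)).1 ((hc _ _).1 h.symm)
        rw [Nat.add_sub_cancel_left] at this
        exact absurd (Nat.le_of_dvd hd this) (by omega)
      rcases Sym2.eq_iff.1 h with ⟨h, -⟩ | ⟨h, h'⟩
      · exact key (1 + t) (by omega) (by omega) (by rwa [← add_assoc])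
      -- Here the edge would recur in reversed direction. In the remaining case `t = N - 2`, and `N
      -- ∣ t` is absurd because `3 ≤ N` makes `t` positive; for `N = 2` both steps would use the
      -- same edge.
      · by_cases ht' : t + 2 < N
        · exact key (t + 2) (by omega) ht' (by rwa [show s + (t + 2) = s + 1 + t + 1 by omega])
        · have h2 := (hc _ _).1 h
          have := (Nat.modEq_iff_dvd' (by omega : s + 1 ≤ s + 1 + t)).1 h2.symm
          rw [Nat.add_sub_cancel_left] at this
          exact absurd (Nat.le_of_dvd (by omega) this) (by omega)
    · exact ⟨0, fun t _ h' => h ⟨_, h'⟩⟩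
  have hfrom (t : ℕ) (ht : t < N) :
      Reach (((completeGraph V).restrict F).deleteEdges {e}) (c s) (c (s + t)) := by
    induction t with
    | zero => exact .refl
    | succ t ih => exact (ih (by omega)).trans (hstep _ (hs t ht))
  have hall (i : ℕ) :
      Reach (((completeGraph V).restrict F).deleteEdges {e}) (c s) (c i) := by
    -- The offset is `i - s` modulo `N`, with `(N - 1) * s` in place of `-s` to stay in the natural
    -- numbers.
    have h : c i = c (s + (i + (N - 1) * s) % N) := by
      rw [hc]
      refine Nat.ModEq.symm (((Nat.mod_modEq _ N).add_left s).trans ?_)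
      rw [show s + (i + (N - 1) * s) = i + N * s by
        obtain ⟨M, rfl⟩ : ∃ M, N = M + 1 := ⟨N - 1, by omega⟩
        simp only [Nat.add_sub_cancel]; ring]
      simp [Nat.ModEq]
    rw [h]
    exact hfrom _ (Nat.mod_lt _ (by omega))
  exact (hall i).symm.trans (hall j)

lemma reach_deleteEdges_of_triangle {F : Set (Sym2 V)} {x y z : V} (hxy : x ≠ y) (hyz : y ≠ z)
    (hzx : z ≠ x) (h₁ : s(x, y) ∈ F) (h₂ : s(y, z) ∈ F) (h₃ : s(z, x) ∈ F) (e : Sym2 V) :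
    Reach (((completeGraph V).restrict F).deleteEdges {e}) x y ∧
      Reach (((completeGraph V).restrict F).deleteEdges {e}) x z := by
  have hinj : Function.Injective ![x, y, z] := by
    intro i j
    fin_cases i <;> fin_cases j <;> simp [hxy, hyz, hzx, hxy.symm, hyz.symm, hzx.symm]
  have h := reach_deleteEdges_of_cycle (F := F) le_rfl (fun i => ![x, y, z] (Fin.ofNat 3 i))
    (fun i j => by rw [hinj.eq_iff, Fin.ext_iff]; rfl) (fun i => by
      have hi : Fin.ofNat 3 (i + 1) = Fin.ofNat 3 i + 1 := by
        simp [Fin.ext_iff, Fin.val_add]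
      simp only [hi]
      generalize Fin.ofNat 3 i = a
      fin_cases a <;> simpa) e
  exact ⟨h 0 1, h 0 2⟩

/-- Double counting: assign to each node an edge of `S` at it; each edge is assigned to at most its
two ends. -/
lemma card_le_two_mul_ncard [Finite V] {S : Set (Sym2 V)} (hS : ∀ x, ∃ e ∈ S, x ∈ e) :
    Nat.card V ≤ 2 * S.ncard := by
  classical
  have := Fintype.ofFinite V
  choose f hfS hf using hS
  rw [Nat.card_eq_fintype_card, Set.ncard_eq_toFinset_card', ← Finset.card_univ]
  refine Finset.card_le_mul_card_image_of_maps_to (f := f) (fun x _ => by simpa using hfS x) 2 ?_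
  intro e _
  induction e with
  | _ a b =>
    refine (Finset.card_le_card (t := {a, b}) fun x hx => ?_).trans Finset.card_le_two
    have hx' := hf x
    rw [(Finset.mem_filter.1 hx).2] at hx'
    simpa using hx'

/-- The set of all pairs `{x, f x}`. -/
def pairEdges (f : V → V) : Set (Sym2 V) :=
  Set.range fun x => s(x, f x)

lemma ncard_pairEdges_le [Finite V] (f : V → V) :
    (pairEdges f).ncard ≤ Nat.card V := by
  rw [pairEdges, ← Set.image_univ, ← Set.ncard_univ]
  exact Set.ncard_image_le

end Complete

/-! ## Complete instances -/

section Instance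

open Classical in
/-- The cost that is zero exactly on the pairs `{x, σ x}`. -/
noncomputable def pairCost {V : Type*} (σ : V → V) (e : Sym2 V) : ℕ :=
  if e ∈ pairEdges σ then 0 else 1

lemma pairCost_eq_zero {V : Type*} {σ : V → V} {e : Sym2 V} :
    pairCost σ e = 0 ↔ e ∈ pairEdges σ := by
  simp [pairCost]

/-- The complete graph on `V` as an instance of MAP: the zero-edges join each node `x` to its mate
`σ x`. -/
noncomputable def completeInstance (V : Type) [Finite V] (σ : V → V)
    (hσ : Function.Involutive σ) (hV : IsTwoEC (completeGraph V)) : MAPInstance where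
  Node := V
  Edge := Sym2 V
  finite_node := inferInstance
  finite_edge := inferInstance
  graph := completeGraph V
  loopless _ _ h := h.2 rfl
  copies_le_two x y := by
    refine le_trans (Set.encard_le_one_iff.2 ?_) one_le_two
    rintro a b ⟨rfl, -⟩ ⟨rfl, -⟩
    rfl
  twoEC := hV
  edgeCost := pairCost σ
  edgeCost_le_one _ _ := by unfold pairCost; split_ifs <;> simp
  matching := by
    have key (e : Sym2 V) (x : V) (he : pairCost σ e = 0) (hx : (completeGraph V).Inc e x) :
        e = s(x, σ x) := by
      obtain ⟨y, rfl⟩ := pairCost_eq_zero.1 he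
      rcases Sym2.mem_iff.1 (completeGraph_inc hx) with rfl | rfl
      · rfl
      · rw [hσ y, Sym2.eq_swap]
    intro e f x he hf hex hfx
    exact (key e x he hex).trans (key f x hf hfx).symm

variable {V : Type} [Finite V] {σ : V → V} {hσ : Function.Involutive σ}
  {hV : IsTwoEC (completeGraph V)}

lemma cost_completeInstance (F : Set (Sym2 V)) :
    (completeInstance V σ hσ hV).cost F = (F \ pairEdges σ).ncard := by
  classical
  have := Fintype.ofFinite V
  change ∑ᶠ (e : Sym2 V) (_ : e ∈ F), pairCost σ e = _
  have hc (e : Sym2 V) : pairCost σ e = if e ∉ pairEdges σ then 1 else 0 := by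
    rw [ite_not]
    rfl
  rw [finsum_mem_eq_finite_toFinset_sum _ (Set.toFinite F)]
  simp only [hc]
  rw [← Finset.card_filter, Set.ncard_eq_toFinset_card _ (Set.toFinite _)]
  congr 1
  ext e
  simp

/-- Four nodes give every node degree at least three, which excludes redundant 4-cycles. The other
conditions hold because an edge is determined by its ends and any two surviving nodes stay adjacent.
-/
lemma wellStructured_completeInstance (h4 : 4 ≤ Nat.card V) :
    (completeInstance V σ hσ hV).WellStructured := by
  have hdeg (x : V) : ((completeGraph V).incidenceSet x).encard ≠ 2 := by
    intro h2
    have hsub : (fun y => s(x, y)) '' {x}ᶜ ⊆ (completeGraph V).incidenceSet x := by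
      rintro _ ⟨y, hy, rfl⟩
      exact ⟨y, rfl, fun h => hy h.symm⟩
    have hle := Set.encard_le_encard hsub
    rw [Function.Injective.encard_image (fun a b h => Sym2.congr_right.1 h), h2,
      ← (Set.toFinite _).cast_ncard_eq] at hle
    have hle' : ({x}ᶜ : Set V).ncard ≤ 2 := by exact_mod_cast hle
    have := Set.ncard_add_ncard_compl ({x} : Set V)
    rw [Set.ncard_singleton] at this
    omega
  refine ⟨?_, ?_, ?_, ?_⟩
  · rintro ⟨e, f, x, y, ⟨rfl, -⟩, ⟨rfl, -⟩, h0, h1⟩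
    omega
  · rintro ⟨u₁, u₂, u₃, u₄, q₁, q₂, q₃, q₄, -, -, -, ⟨h, -⟩ | ⟨h, -⟩⟩
    · exact hdeg _ h
    · exact hdeg _ h
  · rintro ⟨x, -, h⟩
    exact h (preconnected_completeGraph_deleteVerts _)
  · rintro ⟨e, x, y, -, -, h⟩
    exact h (preconnected_completeGraph_deleteVerts _)

/-- A 2-edge cover has at least half as many unit-edges as there are nodes. -/
lemma card_le_two_mul_cost {F : Set (Sym2 V)}
    (hF : (completeInstance V σ hσ hV).IsTwoEdgeCover F) :
    Nat.card V ≤ 2 * (completeInstance V σ hσ hV).cost F := by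
  rw [cost_completeInstance]
  refine card_le_two_mul_ncard fun x => ?_
  obtain ⟨e, ⟨heF, hex⟩, f, ⟨hfF, hfx⟩, hef⟩ :=
    two_le_encard_iff_nontrivial.1 (hF.2 x (Set.mem_univ x))
  -- Of two distinct cover edges at `x`, at most one is a zero-edge, by the matching property.
  by_cases he : e ∈ pairEdges σ
  · refine ⟨f, ⟨hfF, fun hf => hef ?_⟩, completeGraph_inc hfx⟩
    exact (completeInstance V σ hσ hV).matching e f x
      (pairCost_eq_zero.2 he) (pairCost_eq_zero.2 hf) hex hfx
  · exact ⟨e, ⟨heF, he⟩, completeGraph_inc hex⟩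

lemma MAPInstance.IsTwoECSS.isTwoEdgeCover {G : MAPInstance} {F : Set G.Edge}
    (h : G.IsTwoECSS F) : G.IsTwoEdgeCover F := by
  refine ⟨h.1, fun x hx => ?_⟩
  have := h.2.two_le_encard_inc (x := x) hx
  simpa only [MAPInstance.sub, Graph.restrict_inc, and_comm] using this

/-- An edge set of the form `{x f(x)}` that contains all zero-edges has at most half as many
unit-edges as there are nodes. -/
lemma two_mul_cost_pairEdges_le (f : V → V)
    (hf : pairEdges σ ⊆ pairEdges f) :
    2 * (completeInstance V σ hσ hV).cost (pairEdges f) ≤ Nat.card V := by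
  rw [cost_completeInstance]
  have h₁ := Set.ncard_sdiff_add_ncard_of_subset hf
  -- There are at most as many edges as nodes, and the zero-edges among them number at least half
  -- the nodes, since they meet every node.
  have h₂ := ncard_pairEdges_le f
  have h₃ := card_le_two_mul_ncard (S := pairEdges σ)
    fun x => ⟨_, ⟨x, rfl⟩, Sym2.mem_mk_left _ _⟩
  omega

end Instance

/-! ## The instances -/

section Blocks

/-- The nodes of `2n + 1` blocks with four nodes each. -/
abbrev BlockNode (n : ℕ) : Type := Fin (2 * n + 1) × Fin 4

variable {n : ℕ}

/-- The other end of the zero-edge at a node. -/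
def mate (x : BlockNode n) : BlockNode n :=
  (x.1, ![1, 0, 3, 2] x.2)

/-- The next node on the 4-cycle of a block. -/
def rotate (x : BlockNode n) : BlockNode n :=
  (x.1, x.2 + 1)

/-- The `t`-th node of the closed walk that traverses the blocks one after the other. -/
def tourNode (n t : ℕ) : BlockNode n :=
  (Fin.ofNat _ (t / 4), Fin.ofNat 4 t)

/-- The next node on the Hamiltonian cycle that traverses the blocks one after the other. -/
def tourNext (x : BlockNode n) : BlockNode n :=
  tourNode n (4 * x.1 + x.2 + 1)

/-- The node at which the `i`-th block is attached to the other ones. -/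
def corner (n i : ℕ) : BlockNode n :=
  (Fin.ofNat _ i, 0)

/-- The triangle by which the blocks `2i + 1` and `2i + 2` are glued to block `0`. -/
def gluingTriangle (n i : ℕ) : Set (Sym2 (BlockNode n)) :=
  {s(corner n 0, corner n (2 * i + 1)), s(corner n (2 * i + 1), corner n (2 * i + 2)),
    s(corner n (2 * i + 2), corner n 0)}

/-- The 4-cycles of the blocks together with the first `j` gluing triangles. -/
def gluedBlocks (n j : ℕ) : Set (Sym2 (BlockNode n)) :=
  pairEdges rotate ∪ {e | ∃ i < j, e ∈ gluingTriangle n i}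

/-! ### Zero-edges, corners and the Hamiltonian cycle -/

lemma mate_involutive : Function.Involutive (mate (n := n)) := by
  rintro ⟨b, q⟩
  fin_cases q <;> rfl

/-- The position in the block is `t` modulo 4 and the block is `t / 4` modulo `2n + 1`; together
they encode `t` modulo the product. -/
lemma tourNode_eq_iff (i j : ℕ) :
    tourNode n i = tourNode n j ↔ i ≡ j [MOD 4 * (2 * n + 1)] := by
  simp only [tourNode, Prod.mk.injEq, Fin.ext_iff, Fin.val_ofNat, Nat.ModEq, Nat.mod_mul]
  omega

lemma tourNode_val (x : BlockNode n) : tourNode n (4 * x.1 + x.2) = x := by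
  obtain ⟨⟨b, hb⟩, ⟨q, hq⟩⟩ := x
  simp only [tourNode, Prod.mk.injEq, Fin.ext_iff, Fin.val_ofNat]
  rw [show (4 * b + q) / 4 = b by omega, Nat.mod_eq_of_lt hb]
  omega

lemma tourNext_tourNode (t : ℕ) : tourNext (tourNode n t) = tourNode n (t + 1) :=
  (tourNode_eq_iff _ _).2 (((tourNode_eq_iff _ _).1 (tourNode_val (tourNode n t))).add_right 1)

lemma corner_val {i : ℕ} (hi : i ≤ 2 * n) : ((corner n i).1 : ℕ) = i :=
  Nat.mod_eq_of_lt (by omega)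

lemma corner_ne {i j : ℕ} (hi : i ≤ 2 * n) (hj : j ≤ 2 * n) (hij : i ≠ j) :
    corner n i ≠ corner n j := fun h => by
  have := congrArg (fun x : BlockNode n => (x.1 : ℕ)) h
  rw [corner_val hi, corner_val hj] at this
  exact hij this

lemma pairEdges_mate_subset_rotate :
    pairEdges (mate (n := n)) ⊆ pairEdges (rotate (n := n)) := by
  rintro _ ⟨⟨b, q⟩, rfl⟩
  fin_cases q
  · exact ⟨(b, 0), rfl⟩
  · exact ⟨(b, 0), Sym2.eq_swap⟩
  · exact ⟨(b, 2), rfl⟩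
  · exact ⟨(b, 2), Sym2.eq_swap⟩

/-- The tour leaves a block only at position 3, so its steps from positions 0 and 2 are exactly the
zero-edges. -/
lemma tourNext_eq_mate (b : Fin (2 * n + 1)) :
    tourNext (b, 0) = mate (b, 0) ∧ tourNext (b, 2) = mate (b, 2) := by
  have h (q : Fin 4) (hq : (q : ℕ) + 1 < 4) : tourNext (b, q) = (b, q + 1) := by
    rw [← tourNode_val (b, q + 1), tourNext, Fin.val_add_one_of_lt' hq, add_assoc]
  exact ⟨h 0 (by decide), h 2 (by decide)⟩

lemma pairEdges_mate_subset_tourNext :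
    pairEdges (mate (n := n)) ⊆ pairEdges (tourNext (n := n)) := by
  rintro _ ⟨⟨b, q⟩, rfl⟩
  obtain ⟨h₀, h₂⟩ := tourNext_eq_mate b
  fin_cases q
  · exact ⟨(b, 0), by simp only [h₀]; rfl⟩
  · exact ⟨(b, 0), by simp only [h₀]; exact Sym2.eq_swap⟩
  · exact ⟨(b, 2), by simp only [h₂]; rfl⟩
  · exact ⟨(b, 2), by simp only [h₂]; exact Sym2.eq_swap⟩

lemma restrict_isTwoEC_tour :
    IsTwoEC ((completeGraph (BlockNode n)).restrict (pairEdges tourNext)) := by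
  refine isTwoEC_of_reach rfl fun e x y => ?_
  rw [← tourNode_val x, ← tourNode_val y]
  exact reach_deleteEdges_of_cycle (N := 4 * (2 * n + 1)) (by omega) _ tourNode_eq_iff
    (fun t => Set.mem_range.2 ⟨tourNode n t, by simp only [tourNext_tourNode]⟩) e _ _

lemma isTwoEC_completeGraph_blockNode : IsTwoEC (completeGraph (BlockNode n)) :=
  restrict_isTwoEC_tour.mono Graph.restrict_le subset_rfl

/-! ### Components and bridges of the partially glued blocks -/

lemma gluedBlocks_mono {i j : ℕ} (hij : i ≤ j) : gluedBlocks n i ⊆ gluedBlocks n j :=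
  Set.union_subset_union_right _ fun _ ⟨l, hl, he⟩ => ⟨l, hl.trans_le hij, he⟩

lemma gluedBlocks_zero : gluedBlocks n 0 = pairEdges rotate := by
  simp [gluedBlocks]

lemma gluedBlocks_succ (j : ℕ) :
    gluedBlocks n (j + 1) = gluedBlocks n j ∪ gluingTriangle n j := by
  ext e
  simp only [gluedBlocks, Set.mem_union, Set.mem_ofPred_eq, Nat.lt_succ_iff_lt_or_eq, or_and_right,
    exists_or, exists_eq_left, or_assoc]

/-- The index of the component of `gluedBlocks n j` that contains the node `x`. -/
def gluedIndex (j : ℕ) (x : BlockNode n) : ℕ :=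
  if (x.1 : ℕ) ≤ 2 * j then 0 else x.1

lemma gluedIndex_corner {i j : ℕ} (hi : i ≤ 2 * n) :
    gluedIndex j (corner n i) = if i ≤ 2 * j then 0 else i := by
  rw [gluedIndex, corner_val hi]

lemma gluedIndex_eq_of_mem {j : ℕ} (hj : j ≤ n) {x y : BlockNode n}
    (h : s(x, y) ∈ gluedBlocks n j) : gluedIndex j x = gluedIndex j y := by
  rcases h with ⟨z, hz⟩ | ⟨i, hi, h⟩
  · rcases Sym2.eq_iff.1 hz with ⟨rfl, rfl⟩ | ⟨rfl, rfl⟩ <;> rfl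
  · have h₀ : gluedIndex j (corner n 0) = 0 := by rw [gluedIndex_corner] <;> simp
    have h₁ : gluedIndex j (corner n (2 * i + 1)) = 0 := by
      rw [gluedIndex_corner (by omega), if_pos (by omega)]
    have h₂ : gluedIndex j (corner n (2 * i + 2)) = 0 := by
      rw [gluedIndex_corner (by omega), if_pos (by omega)]
    rcases h with h | h | h <;> rcases Sym2.eq_iff.1 h with ⟨rfl, rfl⟩ | ⟨rfl, rfl⟩ <;>
      simp only [h₀, h₁, h₂]

/-- The 4-cycle of the block alone survives the loss of one edge, whatever has been glued. -/
lemma reach_block (j : ℕ) (e : Sym2 (BlockNode n)) (b : Fin (2 * n + 1)) (q q' : Fin 4) :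
    Reach (((completeGraph (BlockNode n)).restrict (gluedBlocks n j)).deleteEdges {e})
      (b, q) (b, q') := by
  have h := reach_deleteEdges_of_cycle (F := gluedBlocks n j) (N := 4) (by omega)
    (fun i => (b, Fin.ofNat 4 i)) (fun i j => by simp [Fin.ext_iff, Nat.ModEq])
    (fun i => .inl ⟨(b, Fin.ofNat 4 i), by simp [rotate, Fin.ext_iff, Fin.val_add]⟩)
    e q q'
  simpa using h

lemma reach_corner {i j : ℕ} (hi : i < j) (hj : j ≤ n) (e : Sym2 (BlockNode n)) :
    Reach (((completeGraph (BlockNode n)).restrict (gluedBlocks n j)).deleteEdges {e})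
        (corner n 0) (corner n (2 * i + 1)) ∧
      Reach (((completeGraph (BlockNode n)).restrict (gluedBlocks n j)).deleteEdges {e})
        (corner n 0) (corner n (2 * i + 2)) :=
  reach_deleteEdges_of_triangle (corner_ne (by omega) (by omega) (by omega))
    (corner_ne (by omega) (by omega) (by omega)) (corner_ne (by omega) (by omega) (by omega))
    (.inr ⟨i, hi, .inl rfl⟩) (.inr ⟨i, hi, .inr (.inl rfl)⟩) (.inr ⟨i, hi, .inr (.inr rfl)⟩) e

/-- Each edge of `gluedBlocks n j` lies on one of its cycles. -/
lemma not_isBridge_gluedBlocks {j : ℕ} (hj : j ≤ n) (e : Sym2 (BlockNode n)) :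
    ¬ IsBridge ((completeGraph (BlockNode n)).restrict (gluedBlocks n j)) e := by
  refine not_isBridge_of_reach fun e x y h => ?_
  obtain ⟨he, rfl, -⟩ := h
  rcases he with ⟨z, hz⟩ | ⟨i, hi, he⟩
  · rcases Sym2.eq_iff.1 hz with ⟨rfl, rfl⟩ | ⟨rfl, rfl⟩ <;> exact reach_block _ _ _ _ _
  · obtain ⟨h₁, h₂⟩ := reach_corner hi hj s(x, y)
    rcases he with he | he | he <;> rcases Sym2.eq_iff.1 he with ⟨rfl, rfl⟩ | ⟨rfl, rfl⟩
    · exact h₁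
    · exact h₁.symm
    · exact h₁.symm.trans h₂
    · exact h₂.symm.trans h₁
    · exact h₂.symm
    · exact h₂

lemma isTwoEC_gluedBlocks :
    IsTwoEC ((completeGraph (BlockNode n)).restrict (gluedBlocks n n)) := by
  refine isTwoEC_of_reach rfl fun e => ?_
  have h (x : BlockNode n) :
      Reach (((completeGraph (BlockNode n)).restrict (gluedBlocks n n)).deleteEdges {e})
        (corner n 0) x := by
    obtain ⟨b, q⟩ := x
    refine Reach.trans ?_ (reach_block n e b 0 q)
    have hb : (b, 0) = corner n b := by simp [corner]
    rw [hb]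
    -- Parity tells which corner of which triangle attaches block `b`: blocks `2i + 1` and `2i + 2`
    -- hang on triangle `i`, and block `0` is the centre.
    obtain ⟨i, hi | hi⟩ := Nat.even_or_odd' (b : ℕ)
    · obtain _ | i := i
      · rw [hi]
        exact .refl
      · rw [hi]
        exact (reach_corner (i := i) (by omega) le_rfl e).2
    · rw [hi]
      exact (reach_corner (i := i) (by omega) le_rfl e).1
  exact fun x y => (h x).symm.trans (h y)

/-- Distinct components of `gluedBlocks n j` are told apart by `gluedIndex`. -/
lemma component_ne_of_gluedIndex_ne {j : ℕ} (hj : j ≤ n) {x y : BlockNode n}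
    (h : gluedIndex j x ≠ gluedIndex j y) :
    component ((completeGraph (BlockNode n)).restrict (gluedBlocks n j)) x ≠
      component ((completeGraph (BlockNode n)).restrict (gluedBlocks n j)) y := by
  intro hxy
  have hy : y ∈ component ((completeGraph (BlockNode n)).restrict (gluedBlocks n j)) x :=
    hxy ▸ Relation.ReflTransGen.refl
  refine h (Reach.apply_eq (gluedIndex j) (fun e x y he => ?_) hy)
  obtain ⟨he, rfl, -⟩ := he
  exact gluedIndex_eq_of_mem hj he

lemma gluingTriangle_edges_ne {j : ℕ} (hj : j < n) :
    s(corner n 0, corner n (2 * j + 1)) ≠ s(corner n (2 * j + 1), corner n (2 * j + 2)) ∧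
    s(corner n 0, corner n (2 * j + 1)) ≠ s(corner n (2 * j + 2), corner n 0) ∧
    s(corner n (2 * j + 1), corner n (2 * j + 2)) ≠ s(corner n (2 * j + 2), corner n 0) := by
  have h₁ : corner n 0 ≠ corner n (2 * j + 1) := corner_ne (by omega) (by omega) (by omega)
  have h₂ : corner n 0 ≠ corner n (2 * j + 2) := corner_ne (by omega) (by omega) (by omega)
  have h₃ : corner n (2 * j + 1) ≠ corner n (2 * j + 2) :=
    corner_ne (by omega) (by omega) (by omega)
  simp [h₁, h₂, h₃, h₁.symm, h₂.symm]

/-- The three corners have the indices `0`, `2j + 1`, `2j + 2`, so each triangle edge joins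
different components. Hence all three edges are new, and they are unit-edges because the zero-edges
are already present. -/
lemma disjoint_gluedBlocks_gluingTriangle {j : ℕ} (hj : j < n) :
    Disjoint (gluedBlocks n j) (gluingTriangle n j) := by
  rw [Set.disjoint_right]
  have h₀ : gluedIndex j (corner n 0) = 0 := by rw [gluedIndex_corner] <;> simp
  have h₁ : gluedIndex j (corner n (2 * j + 1)) = 2 * j + 1 := by
    rw [gluedIndex_corner (by omega), if_neg (by omega)]
  have h₂ : gluedIndex j (corner n (2 * j + 2)) = 2 * j + 2 := by
    rw [gluedIndex_corner (by omega), if_neg (by omega)]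
  rintro e (rfl | rfl | rfl) he <;> have := gluedIndex_eq_of_mem hj.le he <;> omega

/-- The complete instance on `2n + 1` blocks. -/
noncomputable def blockInstance (n : ℕ) : MAPInstance :=
  completeInstance (BlockNode n) mate mate_involutive isTwoEC_completeGraph_blockNode

/-! ### Cost of covers, the optimum and the cost of the glued subgraph -/

lemma card_blockNode : Nat.card (BlockNode n) = 8 * n + 4 := by
  rw [Nat.card_eq_fintype_card, Fintype.card_prod, Fintype.card_fin, Fintype.card_fin]
  omega

lemma four_mul_add_two_le_cost {F : Set (Sym2 (BlockNode n))}
    (hF : (blockInstance n).IsTwoEdgeCover F) : 4 * n + 2 ≤ (blockInstance n).cost F := by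
  have h : Nat.card (BlockNode n) ≤ 2 * (blockInstance n).cost F := card_le_two_mul_cost hF
  rw [card_blockNode] at h
  omega

lemma isTwoEdgeCover_rotate :
    (blockInstance n).IsTwoEdgeCover (pairEdges (rotate (n := n))) := by
  have hne (x : BlockNode n) : x ≠ rotate x := fun h => by
    have := congrArg Prod.snd h
    simp [rotate] at this
  refine ⟨?_, fun x _ => two_le_encard_iff_nontrivial.2 ?_⟩
  · rintro _ ⟨x, rfl⟩
    exact ⟨x, rotate x, rfl, hne x⟩
  · obtain ⟨b, q⟩ := x
    have hr : rotate (b, q - 1) = (b, q) := by simp [rotate]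
    refine ⟨s((b, q), rotate (b, q)), ⟨⟨_, rfl⟩, _, rfl, hne _⟩,
      s((b, q - 1), (b, q)), ⟨⟨(b, q - 1), by simp only [hr]⟩, (b, q - 1), Sym2.eq_swap, ?_⟩, ?_⟩
    · have := hne (b, q - 1)
      rw [hr] at this
      exact this.symm
    · have h2 : q ≠ q - 1 ∧ q + 1 ≠ q - 1 := by
        fin_cases q <;> decide
      have h : s((b, q), rotate (b, q)) ≠ s((b, q - 1), (b, q)) := by
        simp [rotate, h2.1, h2.2]
      exact h

lemma isTwoECSS_tour : (blockInstance n).IsTwoECSS (pairEdges (tourNext (n := n))) := by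
  refine ⟨?_, restrict_isTwoEC_tour⟩
  rintro _ ⟨x, rfl⟩
  refine ⟨x, tourNext x, rfl, fun h => ?_⟩
  rw [← tourNode_val x, tourNext_tourNode, tourNode_eq_iff] at h
  have := (Nat.modEq_iff_dvd' (Nat.le_succ _)).1 h
  rw [Nat.succ_sub (le_refl _), Nat.sub_self] at this
  exact absurd (Nat.le_of_dvd one_pos this) (by omega)

lemma isTwoECSS_gluedBlocks : (blockInstance n).IsTwoECSS (gluedBlocks n n) := by
  refine ⟨?_, isTwoEC_gluedBlocks⟩
  rintro e (he | ⟨i, hi, he⟩)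
  · exact isTwoEdgeCover_rotate.1 he
  · rcases he with rfl | rfl | rfl <;>
      exact ⟨_, _, rfl, corner_ne (by omega) (by omega) (by omega)⟩

lemma cost_rotate : (blockInstance n).cost (pairEdges (rotate (n := n))) = 4 * n + 2 := by
  refine le_antisymm ?_ (four_mul_add_two_le_cost isTwoEdgeCover_rotate)
  have h : 2 * (blockInstance n).cost (pairEdges (rotate (n := n))) ≤ Nat.card (BlockNode n) :=
    two_mul_cost_pairEdges_le _ pairEdges_mate_subset_rotate
  rw [card_blockNode] at h
  omega

/-- The Hamiltonian cycle meets the lower bound valid for all 2-edge covers, and every 2-ECSS is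
such a cover. -/
lemma opt_blockInstance : (blockInstance n).opt = 4 * n + 2 := by
  have h : 2 * (blockInstance n).cost (pairEdges (tourNext (n := n))) ≤ Nat.card (BlockNode n) :=
    two_mul_cost_pairEdges_le _ pairEdges_mate_subset_tourNext
  rw [card_blockNode] at h
  refine le_antisymm (le_trans (Nat.sInf_le ⟨_, isTwoECSS_tour, rfl⟩) (by omega)) ?_
  refine le_csInf ⟨_, _, isTwoECSS_tour, rfl⟩ ?_
  rintro _ ⟨F, hF, rfl⟩
  exact four_mul_add_two_le_cost hF.isTwoEdgeCover

lemma cost_gluedBlocks {j : ℕ} (hj : j ≤ n) :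
    (blockInstance n).cost (gluedBlocks n j) = 4 * n + 2 + 3 * j := by
  induction j with
  | zero => rw [gluedBlocks_zero]; exact cost_rotate
  | succ j ih =>
    have hcost (F : Set (Sym2 (BlockNode n))) :
        (blockInstance n).cost F = (F \ pairEdges mate).ncard := cost_completeInstance F
    have hdisj := disjoint_gluedBlocks_gluingTriangle hj
    have hT : gluingTriangle n j \ pairEdges mate = gluingTriangle n j :=
      (hdisj.mono_left (pairEdges_mate_subset_rotate.trans Set.subset_union_left)).symm.sdiff_eq_left
    have hcard : (gluingTriangle n j).ncard = 3 := by
      obtain ⟨h₁, h₂, h₃⟩ := gluingTriangle_edges_ne hj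
      exact Set.ncard_eq_three.2 ⟨_, _, _, h₁, h₂, h₃, rfl⟩
    have ih := ih (Nat.le_of_succ_le hj)
    rw [hcost] at ih
    rw [gluedBlocks_succ, hcost, Set.union_sdiff_distrib, hT,
      Set.ncard_union_eq (hdisj.mono_left Set.sdiff_subset), ih, hcard]
    ring

/-! ## The execution of the algorithm -/

/-- With no bridges the 2ec-blocks are the components, so `gluedIndex` can tell them apart. -/
lemma blockOf_gluedBlocks {j : ℕ} (hj : j ≤ n) (x : BlockNode n) :
    blockOf ((blockInstance n).sub (gluedBlocks n j)) x =
      component ((completeGraph (BlockNode n)).restrict (gluedBlocks n j)) x :=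
  blockOf_eq_component (not_isBridge_gluedBlocks hj) x

lemma isBlock_gluedBlocks {j : ℕ} (hj : j ≤ n) (x : BlockNode n) :
    IsBlock ((blockInstance n).sub (gluedBlocks n j))
      (blockOf ((blockInstance n).sub (gluedBlocks n j)) x) := by
  refine ⟨?_, x, Set.mem_univ _, rfl⟩
  rw [two_le_encard_iff_nontrivial, blockOf_gluedBlocks hj]
  obtain ⟨b, q⟩ := x
  refine ⟨(b, q), Relation.ReflTransGen.refl, (b, q + 1),
    (reach_block j s((b, q), (b, q)) b q (q + 1)).mono Graph.deleteEdges_le, fun h => ?_⟩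
  have h' : q = q + 1 := congrArg Prod.snd h
  simp at h'

lemma nodup_triple {γ : Type*} {a b c : γ} (hab : a ≠ b) (hac : a ≠ c) (hbc : b ≠ c) :
    [a, b, c].Nodup := by
  simp [hab, hac, hbc]

/-- The triangle contracts to a cycle of length three through the root, so it has sufficient credit
by length alone, although an untouched 4-cycle has only 3/2 credits. -/
lemma glueStep_gluedBlocks {j : ℕ} (hj : j < n) :
    (blockInstance n).GlueStep (gluedBlocks n 0)
      (blockOf ((blockInstance n).sub (gluedBlocks n 0)) (corner n 0))
      (gluedBlocks n j) (gluedBlocks n (j + 1)) := by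
  -- After `j` steps the root has swallowed the blocks up to `2j`, so corner `0` and the corners
  -- beyond `2j` lie in pairwise different blocks.
  have hne {i i' : ℕ} (hi : i ≤ 2 * n) (hi' : i' ≤ 2 * n) (h : i ≠ i')
      (hij : i = 0 ∨ 2 * j < i) (hij' : i' = 0 ∨ 2 * j < i') :
      blockOf ((blockInstance n).sub (gluedBlocks n j)) (corner n i) ≠
        blockOf ((blockInstance n).sub (gluedBlocks n j)) (corner n i') := by
    rw [blockOf_gluedBlocks hj.le, blockOf_gluedBlocks hj.le]
    refine component_ne_of_gluedIndex_ne hj.le ?_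
    rw [gluedIndex_corner hi, gluedIndex_corner hi']
    split_ifs <;> omega
  have hlink {i i' : ℕ} (hi : i ≤ 2 * n) (hi' : i' ≤ 2 * n) (h : i ≠ i') :
      ((blockInstance n).contracted (gluedBlocks n j)).IsLink s(corner n i, corner n i')
        (blockOf ((blockInstance n).sub (gluedBlocks n j)) (corner n i))
        (blockOf ((blockInstance n).sub (gluedBlocks n j)) (corner n i')) :=
    ⟨corner n i, corner n i', ⟨rfl, corner_ne hi hi' h⟩, rfl, rfl⟩
  let c : List (Sym2 (BlockNode n) × Set (BlockNode n)) :=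
    [(s(corner n 0, corner n (2 * j + 1)),
        blockOf ((blockInstance n).sub (gluedBlocks n j)) (corner n (2 * j + 1))),
      (s(corner n (2 * j + 1), corner n (2 * j + 2)),
        blockOf ((blockInstance n).sub (gluedBlocks n j)) (corner n (2 * j + 2))),
      (s(corner n (2 * j + 2), corner n 0),
        blockOf ((blockInstance n).sub (gluedBlocks n j)) (corner n 0))]
  have hc : gluedBlocks n (j + 1) = gluedBlocks n j ∪ edgesOf c := by
    rw [gluedBlocks_succ]
    congr 1
    ext e
    simp [gluingTriangle, edgesOf, c]
  rw [hc]
  refine .cycle (gluedBlocks n j) (blockOf ((blockInstance n).sub (gluedBlocks n j)) (corner n 0))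
    c ⟨isBlock_gluedBlocks hj.le _, ?_⟩ ⟨?_, ?_, ?_, ?_⟩ (.inl le_rfl)
  · rw [blockOf_gluedBlocks (Nat.zero_le n), blockOf_gluedBlocks hj.le]
    intro x hx
    exact Reach.mono (Graph.restrict_mono_right _ (gluedBlocks_mono (Nat.zero_le j))) hx
  · exact Nat.le_succ 2
  · exact ⟨hlink (by omega) (by omega) (by omega), hlink (by omega) (by omega) (by omega),
      hlink (by omega) (by omega) (by omega), ⟨corner n 0, Set.mem_univ _, rfl⟩, rfl⟩
  · have h₁ := hne (i := 2 * j + 1) (i' := 2 * j + 2) (by omega) (by omega) (by omega)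
      (by omega) (by omega)
    have h₂ := hne (i := 2 * j + 1) (i' := 0) (by omega) (by omega) (by omega)
      (by omega) (by omega)
    have h₃ := hne (i := 2 * j + 2) (i' := 0) (by omega) (by omega) (by omega)
      (by omega) (by omega)
    exact nodup_triple h₁ h₂ h₃
  · obtain ⟨h₁, h₂, h₃⟩ := gluingTriangle_edges_ne hj
    exact nodup_triple h₁ h₂ h₃

/-- The algorithm starts from the 4-cycles of the blocks, which have no bridge, and buys the gluing
triangles one after the other. -/
lemma isAlgorithmOutput_gluedBlocks :
    (blockInstance n).IsAlgorithmOutput (gluedBlocks n n) := by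
  have hnb (e : Sym2 (BlockNode n)) :
      ¬ IsBridge ((blockInstance n).sub (gluedBlocks n 0)) e :=
    not_isBridge_gluedBlocks (Nat.zero_le n) e
  have hglue (j : ℕ) (hj : j ≤ n) : Relation.ReflTransGen
      ((blockInstance n).GlueStep (gluedBlocks n 0)
        (blockOf ((blockInstance n).sub (gluedBlocks n 0)) (corner n 0)))
      (gluedBlocks n 0) (gluedBlocks n j) := by
    induction j with
    | zero => exact .refl
    | succ j ih => exact (ih (Nat.le_of_succ_le hj)).tail (glueStep_gluedBlocks hj)
  -- The D2, its post-processed form and the bridgeless subgraph coincide, so the first two phases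
  -- take no steps.
  refine ⟨gluedBlocks n 0, gluedBlocks n 0, gluedBlocks n 0, _, ⟨⟨?_, fun F hF => ?_⟩, ?_⟩,
    ⟨.refl, ?_⟩, ⟨.refl, hnb⟩, isBlock_gluedBlocks (Nat.zero_le n) (corner n 0), hglue n le_rfl,
    isTwoECSS_gluedBlocks⟩
  · rw [gluedBlocks_zero]
    exact isTwoEdgeCover_rotate
  · rw [cost_gluedBlocks (Nat.zero_le n)]
    exact four_mul_add_two_le_cost hF
  · intro e _ he
    exact .inl (pairEdges_mate_subset_rotate (pairCost_eq_zero.1 he))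
  · refine Set.eq_empty_of_forall_notMem ?_
    rintro e ⟨B, -, -, he, -⟩
    exact hnb e he

end Blocks
end MatchAug

theorem mainTheorem4 :
    ∃ (G : ℕ → MatchAug.MAPInstance) (ALGO : ∀ k, Set (G k).Edge),
      (∀ k : ℕ, (G k).WellStructured ∧ (G k).IsAlgorithmOutput (ALGO k) ∧
        7 * k + 6 ≤ (G k).cost (ALGO k) ∧ (G k).opt ≤ 4 * k + 7) ∧
      Filter.Tendsto (fun k : ℕ => ((G k).cost (ALGO k) : ℝ) / ((G k).opt : ℝ))
        Filter.atTop (nhds (7 / 4)) := by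
  -- The shift `n = k + 1` is forced by the additive constants: `7n + 2` must reach `7k + 6`, while
  -- `4n + 2 = 4k + 6` still stays below `4k + 7`.
  have hcost (k : ℕ) : (MatchAug.blockInstance (k + 1)).cost
      (MatchAug.gluedBlocks (k + 1) (k + 1)) = 7 * k + 9 := by
    rw [MatchAug.cost_gluedBlocks le_rfl]
    ring
  have hopt (k : ℕ) : (MatchAug.blockInstance (k + 1)).opt = 4 * k + 6 := by
    rw [MatchAug.opt_blockInstance]
    ring
  refine ⟨fun k => MatchAug.blockInstance (k + 1), fun k => MatchAug.gluedBlocks (k + 1) (k + 1),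
    fun k => ⟨MatchAug.wellStructured_completeInstance ?_,
      MatchAug.isAlgorithmOutput_gluedBlocks, ?_, ?_⟩, ?_⟩
  · rw [MatchAug.card_blockNode]
    omega
  · rw [hcost]
    omega
  · rw [hopt]
    omega
  · simp only [hcost, hopt]
    have hsplit (k : ℕ) : ((7 * k + 9 : ℕ) : ℝ) / ((4 * k + 6 : ℕ) : ℝ) =
        7 / 4 - 3 / 8 * (1 / ((k : ℝ) + 3 / 2)) := by
      push_cast
      field_simp
      ring
    simp only [hsplit]
    have hlim : Filter.Tendsto (fun k : ℕ => 1 / ((k : ℝ) + 3 / 2)) Filter.atTop (nhds 0) := by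
      simp only [one_div]
      exact tendsto_inv_atTop_zero.comp
        (Filter.tendsto_atTop_add_const_right _ _ tendsto_natCast_atTop_atTop)
    simpa using (hlim.const_mul (3 / 8)).const_sub (7 / 4)
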